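/- Let $E$ be a real normed space of finite dimension $d$, let $\tau>0$, and let $\mathscr C=C([-\tau,0];E)$ carry the supremum norm. Let $F:\mathbb R\times\mathscr C\to E$ be such that each $F(t,\cdot)$ is linear and the Carathéodory conditions hold: $F(\cdot,\phi)$ is Lebesgue measurable for every $\phi\in\mathscr C$, $F(\cdot,0)$ is locally integrable, and there is a locally integrable $n:\mathbb R\to[0,\infty)$ with $|F(t,\phi)-F(t,\psi)|\le n(t)|\phi-\psi|$ for all $t,\phi,\psi$. Assume that the operator norm satisfies $|F(t,\cdot)|\le 1$ for all $t\ge 0$. For $s\ge 0$ and $\phi\in\mathscr C$, the solution $x:[s-\tau,\infty)\to E$ of $x'(t)=F(t,x_t)$ with initial function $\phi$ at time $s$ is the continuous function with $x_s=\phi$ and $x(t)=x(s)+\int_s^tF(r,x_r)\,dr$ for $t\ge s$, where $x_t(\theta)=x(t+\theta)$ for $\theta\in[-\tau,0]$; write $x_t(\phi)$ for its segments. Assume uniform stability: there is a constant $M$ such that $$\sup_{t\ge s}|x_t(\phi)|\le M|\phi|\qquad\text{for all } s\ge 0,\ \phi\in\mathscr C .$$ Define $k_0=0$, $k_1=d$,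 $k_2=2d$, $k_i=(2^{i-2}+1)d$ for $i>2$, and $\rho_0=e^{\tau}$; for $i\ge 1$, let $\rho_i=\tau/2^{i-1}$ if $\tau\le 1$, while if $\tau\ge 1$ let $\rho_i=\exp(\tau-2^{i-1})$ for $i\le \frac{\ln\tau}{\ln 2}+1$ and $\rho_i=\tau/2^{i-1}$ for $i>\frac{\ln\tau}{\ln 2}+1$ (for $\tau=1$ the two definitions agree). Let $i\ge 0$ be an integer with $\rho_iM<1$. Then, for every initial time $s\ge 0$, the space of initial functions whose solutions do not tend to zero has dimension at most $k_i$, in the following sense: the linear subspace of all $\phi\in\mathscr C$ whose solution with initial time $s$ tends to $0$ as $t\to\infty$ has codimension at most $k_i$ in $\mathscr C$; equivalently, every linear subspace $W\subseteq\mathscr C$ such that no nonzero $\phi\in W$ has a solution tending to $0$ satisfies $\dim W\le k_i$. -/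

import Mathlib

open Set Filter Topology MeasureTheory

noncomputable section

namespace DelayEq

variable {E : Type*} [NormedAddCommGroup E] [NormedSpace ℝ E]

/-- The phase space `𝒞([-τ, 0]; E)` of continuous functions, with the supremum norm. -/
abbrev Phase (τ : ℝ) (E : Type*) [NormedAddCommGroup E] : Type _ := C(Icc (-τ) (0 : ℝ), E)

/-- The history segment `x_t`, that is `x_t(θ) = x(t + θ)` for `θ ∈ [-τ, 0]`.
(The default value `0` is taken only when `x` is not continuous on `[t - τ, t]`, which never
happens below for solutions.) -/
def seg (τ : ℝ) (x : ℝ → E) (t : ℝ) : Phase τ E :=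
  ContinuousMap.mkD (fun θ : Icc (-τ) (0 : ℝ) => x (t + θ)) 0

/-- The Caratheodory conditions on the right-hand side `F : ℝ × 𝒞([-τ, 0]; E) → E`. -/
structure IsCaratheodory {τ : ℝ} (F : ℝ → Phase τ E → E) : Prop where
  locallyIntegrable_zero : LocallyIntegrable (fun t => F t 0) volume
  measurable : ∀ φ : Phase τ E, AEStronglyMeasurable (fun t => F t φ) volume
  lipschitz : ∃ n : ℝ → ℝ, (∀ t, 0 ≤ n t) ∧ LocallyIntegrable n volume ∧
    ∀ (t : ℝ) (φ ψ : Phase τ E), ‖F t φ - F t ψ‖ ≤ n t * ‖φ - ψ‖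

/-- `x` is a solution on `[s, ∞)` of `x'(t) = F(t, x_t)` with initial function `φ` at time `s`:
`x` is continuous on `[s - τ, ∞)`, `x_s = φ`, and `x(t) = x(s) + ∫_s^t F(r, x_r) dr` for `t ≥ s`
(with an integrable integrand, so that `x` is locally absolutely continuous on `[s, ∞)`).
Only the values of `x` on `[s - τ, ∞)` matter. -/
structure IsSolution {τ : ℝ} (F : ℝ → Phase τ E → E) (s : ℝ) (φ : Phase τ E) (x : ℝ → E) :
    Prop where
  continuousOn : ContinuousOn x (Ici (s - τ))
  initial : ∀ θ : Icc (-τ) (0 : ℝ), x (s + θ) = φ θ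
  intervalIntegrable : ∀ t, s ≤ t → IntervalIntegrable (fun r => F r (seg τ x r)) volume s t
  integral_eq : ∀ t, s ≤ t → x t = x s + ∫ r in s..t, F r (seg τ x r)

/-- Uniform stability with constant `M`: `sup_{t ≥ s} |x_t(φ)| ≤ M |φ|` for all `s ≥ 0` and `φ`,
where `x(φ)` is the solution with initial function `φ` at time `s`. -/
def IsUniformlyStable {τ : ℝ} (F : ℝ → Phase τ E → E) (M : ℝ) : Prop :=
  ∀ s : ℝ, 0 ≤ s → ∀ (φ : Phase τ E) (x : ℝ → E), IsSolution F s φ x →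
    ∀ t, s ≤ t → ‖seg τ x t‖ ≤ M * ‖φ‖

/-- `k_0 = 0`, `k_1 = d`, `k_2 = 2d`, `k_i = (2^(i-2) + 1) d` for `i > 2`. -/
def codimBound (d i : ℕ) : ℕ :=
  if i = 0 then 0 else if i = 1 then d else if i = 2 then 2 * d else (2 ^ (i - 2) + 1) * d

/-- `ρ_0 = exp τ`; for `i ≥ 1`, `ρ_i = τ / 2^(i-1)` if `τ ≤ 1`, and if `τ > 1` then
`ρ_i = exp (τ - 2^(i-1))` when `i ≤ ln τ / ln 2 + 1`, `ρ_i = τ / 2^(i-1)` otherwise. -/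
def growthBound (τ : ℝ) (i : ℕ) : ℝ :=
  if i = 0 then Real.exp τ
  else if τ ≤ 1 then τ / 2 ^ (i - 1)
  else if (i : ℝ) ≤ Real.log τ / Real.log 2 + 1 then Real.exp (τ - 2 ^ (i - 1))
  else τ / 2 ^ (i - 1)

theorem IsSolution.continuous_seg {τ : ℝ} {F : ℝ → Phase τ E → E} {s : ℝ} {φ : Phase τ E}
    {x : ℝ → E} (h : IsSolution F s φ x) {t : ℝ} (ht : s ≤ t) :
    Continuous (fun θ : Icc (-τ) (0 : ℝ) => x (t + θ)) := by
  refine h.continuousOn.comp_continuous (by fun_prop) fun θ => ?_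
  have := θ.2.1
  simp only [mem_Ici]
  linarith

theorem IsSolution.seg_apply {τ : ℝ} {F : ℝ → Phase τ E → E} {s : ℝ} {φ : Phase τ E}
    {x : ℝ → E} (h : IsSolution F s φ x) {t : ℝ} (ht : s ≤ t) (θ : Icc (-τ) (0 : ℝ)) :
    seg τ x t θ = x (t + θ) := by
  rw [seg, ContinuousMap.mkD_apply_of_continuous (h.continuous_seg ht)]

theorem IsSolution.zero {τ : ℝ} (F : ℝ → Phase τ E →L[ℝ] E) (s : ℝ) :
    IsSolution (fun t ψ => F t ψ) s 0 (fun _ => 0) := by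
  have h : ∀ r, seg τ (fun _ => (0 : E)) r = 0 := fun r => by
    ext θ
    rw [seg, ContinuousMap.mkD_apply_of_continuous continuous_const]
    rfl
  exact ⟨continuousOn_const, fun _ => rfl, fun t _ => by simp [h], fun t _ => by simp [h]⟩

theorem IsSolution.add {τ : ℝ} {F : ℝ → Phase τ E →L[ℝ] E} {s : ℝ} {φ ψ : Phase τ E}
    {x y : ℝ → E} (hx : IsSolution (fun t ψ => F t ψ) s φ x)
    (hy : IsSolution (fun t ψ => F t ψ) s ψ y) :
    IsSolution (fun t ψ => F t ψ) s (φ + ψ) (fun t => x t + y t) := by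
  have h : ∀ r, s ≤ r → seg τ (fun t => x t + y t) r = seg τ x r + seg τ y r := fun r hr => by
    have hc : Continuous (fun θ : Icc (-τ) (0 : ℝ) => x (r + θ) + y (r + θ)) :=
      (hx.continuous_seg hr).add (hy.continuous_seg hr)
    ext θ
    rw [ContinuousMap.add_apply, hx.seg_apply hr, hy.seg_apply hr, seg,
      ContinuousMap.mkD_apply_of_continuous hc]
  have h' : ∀ t, s ≤ t → EqOn (fun r => F r (seg τ x r) + F r (seg τ y r))
      (fun r => F r (seg τ (fun t => x t + y t) r)) (uIcc s t) := fun t ht r hr => by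
    rw [uIcc_of_le ht] at hr
    simp [h r hr.1]
  refine ⟨hx.continuousOn.add hy.continuousOn, fun θ => ?_, fun t ht => ?_, fun t ht => ?_⟩
  · simp [hx.initial, hy.initial]
  · exact ((hx.intervalIntegrable t ht).add (hy.intervalIntegrable t ht)).congr
      ((h' t ht).mono uIoc_subset_uIcc)
  · rw [← intervalIntegral.integral_congr (h' t ht), intervalIntegral.integral_add
      (hx.intervalIntegrable t ht) (hy.intervalIntegrable t ht)]
    simp only [hx.integral_eq t ht, hy.integral_eq t ht]
    abel

theorem IsSolution.smul {τ : ℝ} {F : ℝ → Phase τ E →L[ℝ] E} {s : ℝ} {φ : Phase τ E}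
    {x : ℝ → E} (c : ℝ) (hx : IsSolution (fun t ψ => F t ψ) s φ x) :
    IsSolution (fun t ψ => F t ψ) s (c • φ) (fun t => c • x t) := by
  have h : ∀ r, s ≤ r → seg τ (fun t => c • x t) r = c • seg τ x r := fun r hr => by
    have hc : Continuous (fun θ : Icc (-τ) (0 : ℝ) => c • x (r + θ)) :=
      (hx.continuous_seg hr).const_smul c
    ext θ
    rw [ContinuousMap.smul_apply, hx.seg_apply hr, seg,
      ContinuousMap.mkD_apply_of_continuous hc]
  have h' : ∀ t, s ≤ t → EqOn (fun r => c • F r (seg τ x r))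
      (fun r => F r (seg τ (fun t => c • x t) r)) (uIcc s t) := fun t ht r hr => by
    rw [uIcc_of_le ht] at hr
    simp [h r hr.1]
  refine ⟨hx.continuousOn.const_smul c, fun θ => ?_, fun t ht => ?_, fun t ht => ?_⟩
  · simp [hx.initial]
  · exact ((hx.intervalIntegrable t ht).smul c).congr ((h' t ht).mono uIoc_subset_uIcc)
  · rw [← intervalIntegral.integral_congr (h' t ht), intervalIntegral.integral_smul]
    simp only [hx.integral_eq t ht, smul_add]

/-- For a linear equation, the linear space of the initial functions at time `s` whose solution
tends to zero as `t → ∞`. -/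
def decaying {τ : ℝ} (F : ℝ → Phase τ E →L[ℝ] E) (s : ℝ) : Submodule ℝ (Phase τ E) where
  carrier := {φ | ∃ x : ℝ → E, IsSolution (fun t ψ => F t ψ) s φ x ∧ Tendsto x atTop (𝓝 0)}
  zero_mem' := ⟨fun _ => 0, IsSolution.zero F s, tendsto_const_nhds⟩
  add_mem' := by
    rintro φ ψ ⟨x, hx, hx0⟩ ⟨y, hy, hy0⟩
    exact ⟨fun t => x t + y t, hx.add hy, by simpa using hx0.add hy0⟩
  smul_mem' := by
    rintro c φ ⟨x, hx, hx0⟩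
    exact ⟨fun t => c • x t, hx.smul c, by simpa using hx0.const_smul c⟩

end DelayEq

end

/-! Evaluating solutions at the `N` midpoints of a window of length `τ` is linear with values in
`E^N`, so every space of initial functions of dimension above `N * d` contains a unit vector whose
solution vanishes at all of them. As `‖F t‖ ≤ 1`, segments bounded by `c` make this solution
`c`-Lipschitz; the segment ending the window is then at most `c * τ / (2N)`, and stability keeps
later segments below `q * c`, where `q = M * τ / (2N) < 1`. Doing this for windows going to infinity
and taking a limit `φ` on the compact unit sphere gives one decaying solution: stability makes the
approximation of `φ` uniform in time, so every eventual bound on its segments improves by a fixed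
factor below one (`exists_mem_decaying_of_midpt_eq_zero`). Hence a complement of `decaying F s` has
dimension at most `N * d` (`rank_quotient_decaying_le`). For nontrivial `E`, stability forces `1 ≤
M`, so the hypothesis on `ρ_i` leaves only the case `ρ_i = τ / 2^(i-1)`, for which a suitable `N`
has `k_i = N * d`. -/

namespace DelayEq

/-! ### Existence of solutions. -/

section Existence

variable {E : Type*} [NormedAddCommGroup E] {τ : ℝ}

theorem seg_apply_of_continuous {x : ℝ → E} (hx : Continuous x) (r : ℝ)
    (θ : Icc (-τ) (0 : ℝ)) : seg τ x r θ = x (r + θ) := by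
  rw [seg, ContinuousMap.mkD_apply_of_continuous (by fun_prop)]

theorem continuous_seg {x : ℝ → E} (hx : Continuous x) : Continuous (seg τ x) := by
  have h : seg τ x = ContinuousMap.curry
      (⟨fun p : ℝ × Icc (-τ) (0 : ℝ) => x (p.1 + p.2), by fun_prop⟩ :
        C(ℝ × Icc (-τ) (0 : ℝ), E)) := by
    ext r θ
    simp [seg_apply_of_continuous hx]
  rw [h]
  exact ContinuousMap.continuous _

variable [NormedSpace ℝ E]

/-- Freezing `g` at the grid points `k / (n + 1)` leaves a fixed vector on each cell; continuity of
`F t` passes to the limit. -/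
theorem aestronglyMeasurable_apply_of_continuous {G : Type*} [NormedAddCommGroup G]
    [NormedSpace ℝ G] {F : ℝ → G →L[ℝ] E}
    (hF : ∀ φ, AEStronglyMeasurable (fun t => F t φ) volume) {g : ℝ → G} (hg : Continuous g) :
    AEStronglyMeasurable (fun t => F t (g t)) volume := by
  refine aestronglyMeasurable_of_tendsto_ae atTop
    (f := fun (n : ℕ) t => F t (g (⌊((n : ℝ) + 1) * t⌋ / ((n : ℝ) + 1)))) (fun n => ?_)
    (Eventually.of_forall fun t => ?_)
  · have hm : Measurable fun t : ℝ => ⌊((n : ℝ) + 1) * t⌋ :=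
      Int.measurable_floor.comp (measurable_const_mul _)
    have hU : (⋃ k : ℤ, (fun t : ℝ => ⌊((n : ℝ) + 1) * t⌋) ⁻¹' {k}) = univ := by
      ext t; simp
    rw [← Measure.restrict_univ (μ := (volume : Measure ℝ)), ← hU,
      aestronglyMeasurable_iUnion_iff]
    intro k
    refine ((hF (g (k / ((n : ℝ) + 1)))).restrict).congr ?_
    filter_upwards [ae_restrict_mem (hm (measurableSet_singleton k))] with t ht
    have ht' : ⌊((n : ℝ) + 1) * t⌋ = k := ht
    rw [ht']
  · refine ((F t).continuous.tendsto _).comp ((hg.tendsto t).comp ?_)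
    have h1 : Tendsto (fun n : ℕ => t - 1 / ((n : ℝ) + 1)) atTop (𝓝 t) := by
      simpa using tendsto_const_nhds.sub (tendsto_one_div_add_atTop_nhds_zero_nat (𝕜 := ℝ))
    refine tendsto_of_tendsto_of_tendsto_of_le_of_le h1 tendsto_const_nhds (fun n => ?_)
      fun n => ?_
    · have hn : (0 : ℝ) < (n : ℝ) + 1 := by positivity
      have := Int.sub_one_lt_floor (((n : ℝ) + 1) * t)
      have h2 : (t - 1 / ((n : ℝ) + 1)) * ((n : ℝ) + 1) = ((n : ℝ) + 1) * t - 1 := by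
        field_simp
      rw [le_div_iff₀ hn, h2]
      exact this.le
    · have hn : (0 : ℝ) < (n : ℝ) + 1 := by positivity
      have := Int.floor_le (((n : ℝ) + 1) * t)
      rw [div_le_iff₀ hn]
      linarith

/-- The weight `e^{-2(t-s)}` turns the integral of `e^{2(r-s)}` into a factor `1/2`. The term `A`
serves for boundedness of the fixed-point map; `A = 0` gives its contraction. -/
theorem norm_exp_smul_integral_le {g : ℝ → E} {s t A B : ℝ} (hA : 0 ≤ A) (hB : 0 ≤ B)
    (hg : ∀ r, s < r → ‖g r‖ ≤ A + Real.exp (2 * (r - s)) * B) :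
    ‖Real.exp (-(2 * (t - s))) • ∫ r in s..t, (Ioi s).indicator g r‖ ≤ A + B / 2 := by
  rcases le_total t s with hts | hst
  · have h0 : ∫ r in s..t, (Ioi s).indicator g r = 0 := by
      refine intervalIntegral.integral_zero_ae (Eventually.of_forall fun r hr => ?_)
      rw [uIoc_of_ge hts] at hr
      exact indicator_of_notMem (by simpa using hr.2) _
    rw [h0]
    simp only [smul_zero, norm_zero]
    positivity
  · have h1 : ‖∫ r in s..t, (Ioi s).indicator g r‖
        ≤ ∫ r in s..t, (A + Real.exp (2 * (r - s)) * B) := by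
      refine intervalIntegral.norm_integral_le_of_norm_le hst (Eventually.of_forall fun r hr => ?_)
        (Continuous.intervalIntegrable (by fun_prop) _ _)
      rw [indicator_of_mem (by exact hr.1)]
      exact hg r hr.1
    have h2 : ∫ r in s..t, (A + Real.exp (2 * (r - s)) * B)
        = A * (t - s) + (Real.exp (2 * (t - s)) - 1) * (B / 2) := by
      have hd : ∀ r ∈ uIcc s t, HasDerivAt
          (fun r => A * (r - s) + (Real.exp (2 * (r - s)) - 1) * (B / 2))
          (A + Real.exp (2 * (r - s)) * B) r := fun r _ => by
        have h3 : HasDerivAt (fun r : ℝ => r - s) 1 r := (hasDerivAt_id r).sub_const s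
        have h4 := (h3.const_mul A).add ((((h3.const_mul 2).exp).sub_const 1).mul_const (B / 2))
        exact h4.congr_deriv (by ring)
      rw [intervalIntegral.integral_eq_sub_of_hasDerivAt hd
        (Continuous.intervalIntegrable (by fun_prop) _ _)]
      simp
    rw [norm_smul, Real.norm_of_nonneg (Real.exp_pos _).le, Real.exp_neg,
      inv_mul_le_iff₀ (Real.exp_pos _)]
    refine (h1.trans_eq h2).trans ?_
    have h5 : t - s ≤ Real.exp (2 * (t - s)) := by
      have := Real.add_one_le_exp (2 * (t - s))
      linarith
    nlinarith [mul_le_mul_of_nonneg_left h5 hA]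

/-- A linear delay equation whose right-hand side has norm at most one on `[0, ∞)` has a global
solution for every initial function: the integral equation is a contraction for the norm
`sup_t e^{-2(t-s)} |x(t)|`. -/
theorem exists_isSolution [CompleteSpace E] (hτ : 0 ≤ τ) {F : ℝ → Phase τ E →L[ℝ] E}
    (hF : ∀ φ, AEStronglyMeasurable (fun t => F t φ) volume)
    (hF1 : ∀ t : ℝ, 0 ≤ t → ‖F t‖ ≤ 1) {s : ℝ} (hs : 0 ≤ s) (φ : Phase τ E) :
    ∃ x : ℝ → E, IsSolution (fun t ψ => F t ψ) s φ x := by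
  have hτ0 : -τ ≤ 0 := by linarith
  -- `e` extends the initial function by its endpoint values; the bounded unknown `z` is the
  -- weighted remainder.
  let e : ℝ → E := fun t => φ (projIcc (-τ) 0 hτ0 (t - s))
  have he : Continuous e := by fun_prop
  let y : BoundedContinuousFunction ℝ E → ℝ → E := fun z t => e t + Real.exp (2 * (t - s)) • z t
  have hy : ∀ z, Continuous (y z) := fun z => by fun_prop
  let g : BoundedContinuousFunction ℝ E → ℝ → E := fun z r => F r (seg τ (y z) r)
  have hgm : ∀ z, AEStronglyMeasurable (g z) volume := fun z =>
    aestronglyMeasurable_apply_of_continuous hF (continuous_seg (hy z))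
  have hexp : ∀ (r : ℝ) (θ : Icc (-τ) (0 : ℝ)),
      Real.exp (2 * (r + θ - s)) ≤ Real.exp (2 * (r - s)) := fun r θ => by
    have := θ.2.2
    exact Real.exp_le_exp.2 (by linarith)
  have hgb : ∀ z r, s < r → ‖g z r‖ ≤ ‖φ‖ + Real.exp (2 * (r - s)) * ‖z‖ := fun z r hr => by
    refine ((F r).le_of_opNorm_le (hF1 r (by linarith)) _).trans ?_
    rw [one_mul]
    refine (ContinuousMap.norm_le _ (by positivity)).2 fun θ => ?_
    rw [seg_apply_of_continuous (hy z)]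
    refine (norm_add_le _ _).trans (add_le_add (φ.norm_coe_le_norm _) ?_)
    rw [norm_smul, Real.norm_of_nonneg (Real.exp_pos _).le]
    exact mul_le_mul (hexp r θ) (z.norm_coe_le_norm _) (norm_nonneg _) (Real.exp_pos _).le
  have hgi : ∀ z a b, IntervalIntegrable ((Ioi s).indicator (g z)) volume a b := fun z a b => by
    have hc : Continuous fun r => ‖φ‖ + Real.exp (2 * (r - s)) * ‖z‖ := by fun_prop
    refine (hc.intervalIntegrable a b).mono_fun'
      ((hgm z).indicator measurableSet_Ioi).restrict (Eventually.of_forall fun r => ?_)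
    by_cases hr : r ∈ Ioi s
    · beta_reduce
      rw [indicator_of_mem hr]
      exact hgb z r hr
    · beta_reduce
      rw [indicator_of_notMem hr, norm_zero]
      positivity
  -- The indicator makes the image vanish for `t ≤ s`, so a fixed point leaves the past equal to
  -- `e`.
  let T : BoundedContinuousFunction ℝ E → BoundedContinuousFunction ℝ E := fun z =>
    BoundedContinuousFunction.ofNormedAddCommGroup
      (fun t => Real.exp (-(2 * (t - s))) • ∫ r in s..t, (Ioi s).indicator (g z) r)
      ((by fun_prop : Continuous fun t : ℝ => Real.exp (-(2 * (t - s)))).smul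
        (intervalIntegral.continuous_primitive (hgi z) s)) (‖φ‖ + ‖z‖ / 2)
      fun t => norm_exp_smul_integral_le (norm_nonneg _) (norm_nonneg _) (hgb z)
  have hT : ContractingWith (1 / 2) T := by
    refine ⟨by rw [← NNReal.coe_lt_coe]; norm_num, LipschitzWith.of_dist_le_mul fun z w => ?_⟩
    refine (BoundedContinuousFunction.dist_le (by positivity)).2 fun t => ?_
    have h1 : T z t - T w t
        = Real.exp (-(2 * (t - s))) • ∫ r in s..t, (Ioi s).indicator (g z - g w) r := by
      simp only [T, BoundedContinuousFunction.coe_ofNormedAddCommGroup]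
      rw [← smul_sub, ← intervalIntegral.integral_sub (hgi z s t) (hgi w s t), indicator_sub']
      rfl
    rw [dist_eq_norm, h1, dist_eq_norm]
    refine (norm_exp_smul_integral_le (A := 0) le_rfl (norm_nonneg (z - w)) fun r hr => ?_).trans
      (by simp; linarith)
    rw [Pi.sub_apply, ← map_sub, zero_add]
    refine ((F r).le_of_opNorm_le (hF1 r (by linarith)) _).trans ?_
    rw [one_mul]
    refine (ContinuousMap.norm_le _ (by positivity)).2 fun θ => ?_
    rw [ContinuousMap.sub_apply, seg_apply_of_continuous (hy z), seg_apply_of_continuous (hy w)]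
    simp only [y, add_sub_add_left_eq_sub, ← smul_sub]
    rw [norm_smul, Real.norm_of_nonneg (Real.exp_pos _).le]
    exact mul_le_mul (hexp r θ) ((z - w).norm_coe_le_norm _) (norm_nonneg _) (Real.exp_pos _).le
  let z := hT.fixedPoint T
  have hz : T z = z := hT.fixedPoint_isFixedPt
  have hyz : ∀ t, y z t = e t + ∫ r in s..t, (Ioi s).indicator (g z) r := fun t => by
    have h1 : z t = Real.exp (-(2 * (t - s))) • ∫ r in s..t, (Ioi s).indicator (g z) r := by
      conv_lhs => rw [← hz]
      rfl
    simp only [y]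
    rw [h1, smul_smul, ← Real.exp_add]
    simp
  have hpast : ∀ t, t ≤ s → y z t = e t := fun t ht => by
    rw [hyz, intervalIntegral.integral_zero_ae, add_zero]
    refine Eventually.of_forall fun r hr => ?_
    rw [uIoc_of_ge ht] at hr
    exact indicator_of_notMem (by simpa using hr.2) _
  have heq : ∀ t, s ≤ t → EqOn ((Ioi s).indicator (g z)) (g z) (uIoc s t) := fun t ht r hr => by
    rw [uIoc_of_le ht] at hr
    exact indicator_of_mem (by exact hr.1) _
  refine ⟨y z, (hy z).continuousOn, fun θ => ?_, fun t ht => ?_, fun t ht => ?_⟩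
  · rw [hpast _ (by linarith [θ.2.2])]
    simp only [e, add_sub_cancel_left]
    rw [projIcc_val]
  · exact (hgi z s t).congr (heq t ht)
  · rw [hyz t, hpast s le_rfl, intervalIntegral.integral_congr_ae
      (Eventually.of_forall (heq t ht))]
    have h1 : e t = e s := by
      simp only [e, sub_self]
      rw [projIcc_of_right_le hτ0 (by linarith), projIcc_of_right_le hτ0 le_rfl]
    rw [h1]

end Existence

/-! ### Consequences of linearity and stability. -/

section Codimension

variable {E : Type*} [NormedAddCommGroup E] [NormedSpace ℝ E] {τ : ℝ}

theorem IsSolution.restart {F : ℝ → Phase τ E → E} {s t : ℝ} {φ : Phase τ E} {x : ℝ → E}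
    (h : IsSolution F s φ x) (ht : s ≤ t) : IsSolution F t (seg τ x t) x := by
  have hi : ∀ u, t ≤ u → IntervalIntegrable (fun r => F r (seg τ x r)) volume t u := fun u hu =>
    (h.intervalIntegrable t ht).symm.trans (h.intervalIntegrable u (ht.trans hu))
  refine ⟨h.continuousOn.mono (Ici_subset_Ici.2 (by linarith)), fun θ => (h.seg_apply ht θ).symm,
    hi, fun u hu => ?_⟩
  rw [h.integral_eq u (ht.trans hu), h.integral_eq t ht, add_assoc,
    intervalIntegral.integral_add_adjacent_intervals (h.intervalIntegrable t ht) (hi u hu)]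

theorem IsSolution.seg_initial {F : ℝ → Phase τ E → E} {s : ℝ} {φ : Phase τ E} {x : ℝ → E}
    (h : IsSolution F s φ x) : seg τ x s = φ := by
  ext θ
  rw [h.seg_apply le_rfl, h.initial]

theorem IsSolution.norm_apply_le {F : ℝ → Phase τ E → E} (hτ : 0 ≤ τ) {s : ℝ} {φ : Phase τ E}
    {x : ℝ → E} (h : IsSolution F s φ x) {t : ℝ} (ht : s ≤ t) : ‖x t‖ ≤ ‖seg τ x t‖ := by
  have := (seg τ x t).norm_coe_le_norm ⟨0, by simpa using hτ, le_rfl⟩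
  rwa [h.seg_apply ht, add_zero] at this

theorem IsSolution.norm_sub_le {F : ℝ → Phase τ E →L[ℝ] E} (hF1 : ∀ t : ℝ, 0 ≤ t → ‖F t‖ ≤ 1)
    {s : ℝ} (hs : 0 ≤ s) {φ : Phase τ E} {x : ℝ → E} (h : IsSolution (fun t ψ => F t ψ) s φ x)
    {a c : ℝ} (ha : s ≤ a) (hc : ∀ t, a ≤ t → ‖seg τ x t‖ ≤ c) {t u : ℝ} (ht : a ≤ t)
    (hu : a ≤ u) : ‖x u - x t‖ ≤ c * |u - t| := by
  have h1 : x u - x t = ∫ r in t..u, F r (seg τ x r) := by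
    rw [h.integral_eq u (ha.trans hu), h.integral_eq t (ha.trans ht), add_sub_add_left_eq_sub,
      intervalIntegral.integral_interval_sub_left (h.intervalIntegrable u (ha.trans hu))
        (h.intervalIntegrable t (ha.trans ht))]
  rw [h1]
  refine intervalIntegral.norm_integral_le_of_norm_le_const fun r hr => ?_
  have hr' : a ≤ r := (le_inf ht hu).trans hr.1.le
  refine ((F r).le_of_opNorm_le (hF1 r (by linarith)) _).trans ?_
  rw [one_mul]
  exact hc r hr'

theorem IsSolution.sub {F : ℝ → Phase τ E →L[ℝ] E} {s : ℝ} {φ ψ : Phase τ E} {x y : ℝ → E}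
    (hx : IsSolution (fun t ψ => F t ψ) s φ x) (hy : IsSolution (fun t ψ => F t ψ) s ψ y) :
    IsSolution (fun t ψ => F t ψ) s (φ - ψ) (fun t => x t - y t) := by
  simpa [sub_eq_add_neg] using hx.add (hy.smul (-1))

theorem IsSolution.norm_sub_le_of_stable {F : ℝ → Phase τ E →L[ℝ] E} {M : ℝ}
    (hM : IsUniformlyStable (fun t φ => F t φ) M) {s : ℝ} (hs : 0 ≤ s) {φ ψ : Phase τ E}
    {x y : ℝ → E} (hx : IsSolution (fun t ψ => F t ψ) s φ x)
    (hy : IsSolution (fun t ψ => F t ψ) s ψ y) {t : ℝ} (ht : s ≤ t) :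
    ‖seg τ x t - seg τ y t‖ ≤ M * ‖φ - ψ‖ := by
  have h := hM s hs _ _ (hx.sub hy) t ht
  have h1 : seg τ (fun t => x t - y t) t = seg τ x t - seg τ y t := by
    ext θ
    rw [(hx.sub hy).seg_apply ht, ContinuousMap.sub_apply, hx.seg_apply ht, hy.seg_apply ht]
  rwa [h1] at h

/-- Stability applied to the difference, which has zero initial function, replaces a Gronwall
argument. -/
theorem IsSolution.unique {F : ℝ → Phase τ E →L[ℝ] E} {M : ℝ} (hτ : 0 ≤ τ)
    (hM : IsUniformlyStable (fun t φ => F t φ) M) {s : ℝ} (hs : 0 ≤ s) {φ : Phase τ E}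
    {x y : ℝ → E} (hx : IsSolution (fun t ψ => F t ψ) s φ x)
    (hy : IsSolution (fun t ψ => F t ψ) s φ y) {t : ℝ} (ht : s ≤ t) : x t = y t := by
  have h := ((hx.sub hy).norm_apply_le hτ ht).trans (hM s hs _ _ (hx.sub hy) t ht)
  simpa [sub_eq_zero] using h

/-! ### Solutions vanishing at the midpoints of a window. -/

/-- The `j`-th of the midpoints of `N` equal parts of `[a, a + τ]`. -/
noncomputable def midpt (τ a : ℝ) (N j : ℕ) : ℝ := a + (2 * j + 1) * (τ / (2 * N))

theorem exists_abs_sub_midpt_le {a u : ℝ} {N : ℕ} (hN : 0 < N) (hτ : 0 < τ) (hau : a ≤ u)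
    (hua : u ≤ a + τ) : ∃ j : Fin N, |u - midpt τ a N j| ≤ τ / (2 * N) := by
  have hN' : (0 : ℝ) < N := by exact_mod_cast hN
  set h : ℝ := τ / (2 * N) with hh
  have h0 : 0 < h := by positivity
  have hNh : 2 * h * N = τ := by rw [hh]; field_simp
  rcases hua.lt_or_eq with hlt | rfl
  · have hv : 0 ≤ (u - a) / (2 * h) := div_nonneg (by linarith) (by linarith)
    have hj : ⌊(u - a) / (2 * h)⌋₊ < N := by
      rw [Nat.floor_lt hv, div_lt_iff₀ (by linarith)]
      linarith
    refine ⟨⟨_, hj⟩, ?_⟩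
    have h1 := Nat.floor_le hv
    have h2 := Nat.lt_floor_add_one ((u - a) / (2 * h))
    rw [le_div_iff₀ (by linarith)] at h1
    rw [div_lt_iff₀ (by linarith)] at h2
    simp only [midpt, ← hh]
    rw [abs_le]
    constructor <;> linarith
  -- At the right endpoint the floor would be `N`, so the last cell is used.
  · refine ⟨⟨N - 1, by omega⟩, ?_⟩
    simp only [midpt, ← hh]
    rw [Nat.cast_sub hN, abs_le]
    push_cast
    constructor <;> linarith

theorem IsSolution.norm_seg_le_of_midpt_eq_zero {F : ℝ → Phase τ E →L[ℝ] E} (hτ : 0 < τ)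
    (hF1 : ∀ t : ℝ, 0 ≤ t → ‖F t‖ ≤ 1) {s : ℝ} (hs : 0 ≤ s) {φ : Phase τ E} {x : ℝ → E}
    (h : IsSolution (fun t ψ => F t ψ) s φ x) {a c : ℝ} (ha : s ≤ a) (hc0 : 0 ≤ c)
    (hc : ∀ t, a ≤ t → ‖seg τ x t‖ ≤ c) {N : ℕ} (hN : 0 < N)
    (hx : ∀ j : Fin N, x (midpt τ a N j) = 0) : ‖seg τ x (a + τ)‖ ≤ c * (τ / (2 * N)) := by
  refine (ContinuousMap.norm_le _ (by positivity)).2 fun θ => ?_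
  rw [h.seg_apply (by linarith)]
  have h1 := θ.2.1
  have h2 := θ.2.2
  obtain ⟨j, hj⟩ := exists_abs_sub_midpt_le (a := a) (u := a + τ + θ) hN hτ (by linarith)
    (by linarith)
  have h3 : a ≤ midpt τ a N j := by
    have : (0 : ℝ) ≤ (2 * j + 1) * (τ / (2 * N)) := by positivity
    simp only [midpt]
    linarith
  have h4 := h.norm_sub_le hF1 hs ha hc h3 (u := a + τ + θ) (by linarith)
  rw [hx j, sub_zero] at h4
  exact h4.trans (mul_le_mul_of_nonneg_left hj hc0)

/-- Iterating with `p = (1 + q) / 2` instead of `q` keeps the successive bounds positive even when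
`q = 0`. -/
theorem tendsto_zero_of_eventually_le_mul {f : ℝ → ℝ} (hf0 : ∀ t, 0 ≤ f t) {q C : ℝ}
    (hq0 : 0 ≤ q) (hq : q < 1) (hC : 0 < C) (hfC : ∀ᶠ t in atTop, f t ≤ C)
    (hstep : ∀ c, 0 < c → (∀ᶠ t in atTop, f t ≤ c) → ∀ᶠ t in atTop, f t ≤ q * c) :
    Tendsto f atTop (𝓝 0) := by
  set p := (1 + q) / 2 with hp
  have hp0 : 0 < p := by linarith
  have hpow : ∀ n : ℕ, ∀ᶠ t in atTop, f t ≤ p ^ n * C := fun n => by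
    induction n with
    | zero => simpa using hfC
    | succ n ih =>
      filter_upwards [hstep _ (by positivity) ih] with t ht
      refine ht.trans ?_
      rw [pow_succ', mul_assoc]
      exact mul_le_mul_of_nonneg_right (by linarith) (by positivity)
  refine tendsto_order.2 ⟨fun b hb => Eventually.of_forall fun t => hb.trans_le (hf0 t),
    fun b hb => ?_⟩
  have ht : Tendsto (fun n : ℕ => p ^ n * C) atTop (𝓝 0) := by
    simpa using (tendsto_pow_atTop_nhds_zero_of_lt_one hp0.le (by linarith)).mul_const C
  obtain ⟨n, hn⟩ := (ht.eventually_lt_const hb).exists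
  filter_upwards [hpow n] with t ht
  exact ht.trans_lt hn

/-- If for a sequence of times tending to infinity some unit vector of a finite-dimensional space
of initial functions has a solution vanishing at `N` equidistant points of the window of length
`τ`, then that space contains a unit vector with a solution tending to zero. -/
theorem exists_mem_decaying_of_midpt_eq_zero {F : ℝ → Phase τ E →L[ℝ] E} (hτ : 0 < τ)
    (hF1 : ∀ t : ℝ, 0 ≤ t → ‖F t‖ ≤ 1) {M : ℝ} (hM0 : 0 ≤ M)
    (hM : IsUniformlyStable (fun t φ => F t φ) M) {s : ℝ} (hs : 0 ≤ s) {N : ℕ} (hN : 0 < N)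
    (hq : τ / (2 * N) * M < 1) {X : Phase τ E → ℝ → E}
    (hX : ∀ φ, IsSolution (fun t ψ => F t ψ) s φ (X φ)) (W : Submodule ℝ (Phase τ E))
    [FiniteDimensional ℝ W]
    (hW : ∀ n : ℕ, ∃ φ : W, ‖φ‖ = 1 ∧ ∀ j : Fin N, X φ (midpt τ (s + n) N j) = 0) :
    ∃ φ ∈ W, ‖φ‖ = 1 ∧ φ ∈ decaying F s := by
  choose ψ hψ1 hψ0 using hW
  have : ProperSpace W := FiniteDimensional.proper ℝ W
  obtain ⟨φ, hφ, k, hk, hlim⟩ := (isCompact_sphere (0 : W) 1).tendsto_subseq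
    (x := ψ) (fun n => by simpa using hψ1 n)
  have hφ1 : ‖(φ : Phase τ E)‖ = 1 := by simpa using hφ
  refine ⟨φ, φ.2, hφ1, X φ, hX φ, ?_⟩
  have hb : ∀ t, s ≤ t → ‖seg τ (X φ) t‖ ≤ M := fun t ht => by
    simpa [hφ1] using hM s hs _ _ (hX φ) t ht
  set q := τ / (2 * N) * M with hqd
  have hq0 : 0 ≤ q := by positivity
  suffices h : Tendsto (fun t => ‖seg τ (X φ) t‖) atTop (𝓝 0) by
    refine squeeze_zero_norm' ?_ h
    filter_upwards [eventually_ge_atTop s] with t ht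
    exact (hX φ).norm_apply_le hτ.le ht
  -- The factor exceeds `q` to absorb the error of replacing `φ` by `ψ (k n)`; `M + 1` is a positive
  -- bound.
  refine tendsto_zero_of_eventually_le_mul (q := (1 + q) / 2) (C := M + 1)
    (fun t => norm_nonneg _) (by linarith) (by linarith) (by linarith)
    (by filter_upwards [eventually_ge_atTop s] with t ht using (hb t ht).trans (by linarith)) ?_
  intro c hc hev
  obtain ⟨T, hT⟩ := eventually_atTop.1 hev
  -- Chosen so that `q * (c + ε) + ε ≤ (1 + q) / 2 * c`, using `1 + q ≤ 2`.
  set ε := c * ((1 - q) / 4) with hε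
  have hε0 : 0 < ε := mul_pos hc (by linarith)
  have h1 : Tendsto (fun n => M * ‖((ψ (k n) : Phase τ E)) - φ‖) atTop (𝓝 0) := by
    have h2 := (tendsto_iff_norm_sub_tendsto_zero.1 hlim).const_mul M
    rw [mul_zero] at h2
    exact h2
  obtain ⟨n, hn, hnT⟩ := ((h1.eventually_lt_const hε0).and
    (eventually_ge_atTop ⌈T - s⌉₊)).exists
  have hnT' : T ≤ s + (k n : ℝ) := by
    have h3 : (⌈T - s⌉₊ : ℝ) ≤ (k n : ℝ) := by exact_mod_cast hnT.trans (hk.id_le n)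
    linarith [Nat.le_ceil (T - s)]
  have hsa : s ≤ s + (k n : ℝ) := by simp
  have hd : ∀ t, s ≤ t → ‖seg τ (X (ψ (k n))) t - seg τ (X φ) t‖ ≤ ε := fun t ht =>
    ((hX _).norm_sub_le_of_stable hM hs (hX _) ht).trans hn.le
  have hbd : ∀ t, s + (k n : ℝ) ≤ t → ‖seg τ (X (ψ (k n))) t‖ ≤ c + ε := fun t ht =>
    (norm_le_norm_add_norm_sub _ _).trans
      (add_le_add (hT t (hnT'.trans ht))
        ((norm_sub_rev _ _).trans_le (hd t (hsa.trans ht))))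
  have hsmall := (hX (ψ (k n))).norm_seg_le_of_midpt_eq_zero hτ hF1 hs hsa
    (by positivity) hbd hN (hψ0 (k n))
  have hs' : s ≤ s + (k n : ℝ) + τ := by linarith
  filter_upwards [eventually_ge_atTop (s + (k n : ℝ) + τ)] with t ht
  have h4 := hM _ (hs.trans hs') _ _ ((hX (ψ (k n))).restart hs') t ht
  have h5 := mul_le_mul_of_nonneg_left hsmall hM0
  have h6 : ‖seg τ (X φ) t‖ ≤ ‖seg τ (X (ψ (k n))) t‖ + ε :=
    (norm_le_norm_add_norm_sub _ _).trans (add_le_add le_rfl (hd t (hs'.trans ht)))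
  have h7 : M * ((c + ε) * (τ / (2 * N))) = q * (c + ε) := by rw [hqd]; ring
  nlinarith [mul_le_mul_of_nonneg_right hq.le hε0.le]

/-! ### The codimension bound. -/

theorem rank_quotient_decaying_le [FiniteDimensional ℝ E] {F : ℝ → Phase τ E →L[ℝ] E}
    (hτ : 0 < τ) (hF : IsCaratheodory (fun t φ => F t φ)) (hF1 : ∀ t : ℝ, 0 ≤ t → ‖F t‖ ≤ 1)
    {M : ℝ} (hM0 : 0 ≤ M) (hM : IsUniformlyStable (fun t φ => F t φ) M) {s : ℝ} (hs : 0 ≤ s)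
    {N : ℕ} (hN : 0 < N) (hq : τ / (2 * N) * M < 1) :
    Module.rank ℝ (Phase τ E ⧸ decaying F s) ≤ (N * Module.finrank ℝ E : ℕ) := by
  have : CompleteSpace E := FiniteDimensional.complete ℝ E
  choose X hX using exists_isSolution hτ.le hF.measurable hF1 hs
  by_contra! hlt
  -- If the bound fails, a complement contains `N * d + 1` independent vectors, and their span meets
  -- `decaying F s` only in zero.
  obtain ⟨C, hC⟩ := (decaying F s).exists_isCompl
  have hrk : ((N * Module.finrank ℝ E + 1 : ℕ) : Cardinal) ≤ Module.rank ℝ C := by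
    rw [← ((decaying F s).quotientEquivOfIsCompl C hC).rank_eq]
    push_cast at hlt ⊢
    exact Cardinal.add_one_le_of_lt hlt
  obtain ⟨v, hv⟩ := Module.le_rank_iff.1 hrk
  have hv' : LinearIndependent ℝ (fun i => (v i : Phase τ E)) :=
    hv.map' C.subtype C.ker_subtype
  set W := Submodule.span ℝ (range fun i => (v i : Phase τ E)) with hWdef
  have hWC : W ≤ C := Submodule.span_le.2 (by rintro _ ⟨i, rfl⟩; exact (v i).2)
  have : FiniteDimensional ℝ W := FiniteDimensional.span_of_finite ℝ (finite_range _)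
  have hWrk : Module.finrank ℝ W = N * Module.finrank ℝ E + 1 := by
    rw [hWdef, finrank_span_eq_card hv', Fintype.card_fin]
  obtain ⟨φ, hφW, hφ1, hφ⟩ := exists_mem_decaying_of_midpt_eq_zero hτ hF1 hM0 hM hs hN hq hX W
    fun n => by
      have ht : ∀ j : Fin N, s ≤ midpt τ (s + n) N j := fun j => by
        have : (0 : ℝ) ≤ n + (2 * j + 1) * (τ / (2 * N)) := by positivity
        simp only [midpt]
        linarith
      -- The chosen solutions depend linearly on the initial function by uniqueness.
      let L : W →ₗ[ℝ] Fin N → E :=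
        { toFun := fun φ j => X φ (midpt τ (s + n) N j)
          map_add' := fun φ ψ => funext fun j =>
            (hX _).unique hτ.le hM hs ((hX φ).add (hX ψ)) (ht j)
          map_smul' := fun c φ => funext fun j =>
            (hX _).unique hτ.le hM hs ((hX φ).smul c) (ht j) }
      have hker : LinearMap.ker L ≠ ⊥ := LinearMap.ker_ne_bot_of_finrank_lt (by
        rw [hWrk, Module.finrank_pi_fintype]
        simp)
      obtain ⟨φ, hφL, hφ0⟩ := Submodule.exists_mem_ne_zero_of_ne_bot hker
      refine ⟨(‖(φ : Phase τ E)‖⁻¹ : ℝ) • φ, ?_, fun j => ?_⟩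
      · change ‖(‖(φ : Phase τ E)‖⁻¹ : ℝ) • (φ : Phase τ E)‖ = 1
        rw [norm_smul, norm_inv, norm_norm]
        exact inv_mul_cancel₀ (norm_ne_zero_iff.2 (by simpa using hφ0))
      have h1 : L ((‖(φ : Phase τ E)‖⁻¹ : ℝ) • φ) = 0 := by
        rw [map_smul, LinearMap.mem_ker.1 hφL, smul_zero]
      exact congrFun h1 j
  have h0 : φ = 0 := Submodule.disjoint_def.1 hC.disjoint φ hφ (hWC hφW)
  simp [h0] at hφ1

/-! ### The constants `M`, `ρ_i` and `k_i`. -/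

theorem one_le_of_isUniformlyStable [FiniteDimensional ℝ E] [Nontrivial E]
    {F : ℝ → Phase τ E →L[ℝ] E} (hτ : 0 ≤ τ) (hF : IsCaratheodory (fun t φ => F t φ))
    (hF1 : ∀ t : ℝ, 0 ≤ t → ‖F t‖ ≤ 1) {M : ℝ}
    (hM : IsUniformlyStable (fun t φ => F t φ) M) : 1 ≤ M := by
  have : CompleteSpace E := FiniteDimensional.complete ℝ E
  have : Nonempty (Icc (-τ) (0 : ℝ)) := ⟨⟨0, by simpa using hτ, le_rfl⟩⟩
  obtain ⟨φ, hφ⟩ := exists_ne (0 : Phase τ E)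
  obtain ⟨x, hx⟩ := exists_isSolution hτ hF.measurable hF1 le_rfl φ
  have h := hM 0 le_rfl φ x hx 0 le_rfl
  rw [hx.seg_initial] at h
  exact (le_mul_iff_one_le_left (norm_pos_iff.2 hφ)).1 h

theorem growthBound_of_mul_lt_one {M : ℝ} (hτ : 0 < τ) (hM : 1 ≤ M) {i : ℕ}
    (hi : growthBound τ i * M < 1) : i ≠ 0 ∧ growthBound τ i = τ / 2 ^ (i - 1) := by
  have h1 : growthBound τ i < 1 := by
    by_contra! h
    nlinarith
  have hi0 : i ≠ 0 := by
    rintro rfl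
    simp only [growthBound, if_true, Real.exp_lt_one_iff] at h1
    linarith
  refine ⟨hi0, ?_⟩
  rw [growthBound, if_neg hi0] at h1 ⊢
  split_ifs at h1 ⊢ with h2 h3
  · rfl
  · exfalso
    -- In the exponential case `2^(i-1) ≤ τ`, hence `ρ_i ≥ 1`, a contradiction.
    have h4 : ((i - 1 : ℕ) : ℝ) * Real.log 2 ≤ Real.log τ := by
      rw [← le_div_iff₀ (Real.log_pos one_lt_two), Nat.cast_sub (Nat.one_le_iff_ne_zero.2 hi0)]
      push_cast
      linarith
    rw [← Real.log_pow, Real.log_le_log_iff (by positivity) hτ] at h4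
    rw [Real.exp_lt_one_iff] at h1
    linarith
  · rfl

/-- The last inequality turns `τ / 2^(i-1) * M < 1` into `τ / (2N) * M < 1`. -/
theorem exists_codimBound_eq_mul (d : ℕ) {i : ℕ} (hi : i ≠ 0) :
    ∃ N : ℕ, 0 < N ∧ codimBound d i = N * d ∧ 2 ^ (i - 1) ≤ 2 * N := by
  rcases i with _ | _ | _ | i
  · exact absurd rfl hi
  · exact ⟨1, by simp [codimBound]⟩
  · exact ⟨2, by simp [codimBound]⟩
  · refine ⟨2 ^ (i + 1) + 1, by simp, by simp [codimBound], ?_⟩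
    simp only [Nat.add_sub_cancel, pow_succ]
    omega

end Codimension

end DelayEq

theorem mainTheorem10 {E : Type*} [NormedAddCommGroup E] [NormedSpace ℝ E]
    [FiniteDimensional ℝ E] (d : ℕ) (hd : Module.finrank ℝ E = d)
    (τ : ℝ) (hτ : 0 < τ)
    (F : ℝ → DelayEq.Phase τ E →L[ℝ] E)
    (hF : DelayEq.IsCaratheodory (fun t φ => F t φ))
    (hF1 : ∀ t : ℝ, 0 ≤ t → ‖F t‖ ≤ 1)
    (M : ℝ) (hM : DelayEq.IsUniformlyStable (fun t φ => F t φ) M)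
    (i : ℕ) (hi : DelayEq.growthBound τ i * M < 1)
    (s : ℝ) (hs : 0 ≤ s) :
    Module.rank ℝ (DelayEq.Phase τ E ⧸ DelayEq.decaying F s) ≤ (DelayEq.codimBound d i : ℕ) ∧
    ∀ W : Submodule ℝ (DelayEq.Phase τ E),
      (∀ φ ∈ W, φ ≠ 0 → ∃ x : ℝ → E,
        DelayEq.IsSolution (fun t ψ => F t ψ) s φ x ∧ ¬ Tendsto x atTop (𝓝 0)) →
      Module.rank ℝ W ≤ (DelayEq.codimBound d i : ℕ) := by
  have key : Module.rank ℝ (DelayEq.Phase τ E ⧸ DelayEq.decaying F s)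
      ≤ (DelayEq.codimBound d i : ℕ) := by
    -- When `E` is trivial, `M` may be below one, but the phase space is zero.
    rcases subsingleton_or_nontrivial E with hE | hE
    · have : Subsingleton (DelayEq.Phase τ E) := ⟨fun φ ψ => by ext; exact Subsingleton.elim _ _⟩
      have : Subsingleton (DelayEq.Phase τ E ⧸ DelayEq.decaying F s) :=
        (Submodule.mkQ_surjective _).subsingleton
      simp [rank_subsingleton']
    · have hM1 := DelayEq.one_le_of_isUniformlyStable hτ.le hF hF1 hM
      obtain ⟨hi0, hg⟩ := DelayEq.growthBound_of_mul_lt_one hτ hM1 hi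
      obtain ⟨N, hN, hk, hle⟩ := DelayEq.exists_codimBound_eq_mul d hi0
      rw [hk, ← hd]
      refine DelayEq.rank_quotient_decaying_le hτ hF hF1 (by linarith) hM hs hN
        (lt_of_le_of_lt (mul_le_mul_of_nonneg_right ?_ (by linarith)) hi)
      rw [hg]
      exact div_le_div_of_nonneg_left hτ.le (by positivity) (by exact_mod_cast hle)
  refine ⟨key, fun W hW => le_trans ?_ key⟩
  -- By uniqueness `W` meets `decaying F s` only in zero, so it embeds in the quotient.
  refine LinearMap.rank_le_of_injective ((DelayEq.decaying F s).mkQ.domRestrict W)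
    ((injective_iff_map_eq_zero _).2 fun φ hφ => ?_)
  by_contra h0
  obtain ⟨x, hx, hx0⟩ := hW φ φ.2 (by simpa using h0)
  obtain ⟨y, hy, hy0⟩ := (Submodule.Quotient.mk_eq_zero _).1 hφ
  refine hx0 (hy0.congr' ?_)
  filter_upwards [eventually_ge_atTop s] with t ht
  exact hy.unique hτ.le hM hs hx ht
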